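/- Let $d,s$ be non-negative integers and let $h_1,\dots,h_s\in\mathbb{R}^d$ be such that the additive subgroup $h_1\mathbb{Z}+\cdots+h_s\mathbb{Z}$ is dense in $\mathbb{R}^d$. For $h\in\mathbb{R}^d$ let $\tau_h$ be the translation operator on complex-valued distributions on $\mathbb{R}^d$, $\langle\tau_h f,\varphi\rangle=\langle f,\varphi(\cdot-h)\rangle$ for test functions $\varphi$ (so $\tau_hf(x)=f(x+h)$ for functions). Let $f$ be a complex-valued distribution on $\mathbb{R}^d$ and suppose that there are natural numbers $n_1,\dots,n_s$ (zero allowed) with $$\dim_{\mathbb{C}}\,\mathrm{span}_{\mathbb{C}}\{f,\tau_{h_i}f,\dots,(\tau_{h_i})^{n_i}f\}\le n_i,\qquad i=1,\dots,s.$$ Then $f$ is, in the distributional sense, a continuous exponential polynomial: there is a function $p:\mathbb{R}^d\to\mathbb{C}$ that is a finite complex linear combination of exponential monomials $x\mapsto x^{\alpha}e^{\langle x,\lambda\rangle}$, with $\alpha\in\mathbb{N}^d$, $\lambda\in\mathbb{C}^d$ and $\langle x,\lambda\rangle=\sum_j x_j\lambda_j$ (in particular $p$ is continuous), such that $\langle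 f,\varphi\rangle=\int_{\mathbb{R}^d}\varphi(x)\,p(x)\,dx$ for every test function $\varphi$. In particular, $f$ is an ordinary function which is equal to an exponential polynomial almost everywhere in the Lebesgue measure: every locally integrable $g:\mathbb{R}^d\to\mathbb{C}$ that represents $f$, i.e. $\langle f,\varphi\rangle=\int \varphi g\,dx$ for all test functions $\varphi$, satisfies $g=p$ almost everywhere. -/

import Mathlib

open MeasureTheory TopologicalSpace
open scoped Distributions

namespace ExpPoly

/-- Translation of test functions, `φ ↦ φ(· - h)`, as a continuous linear map of the space of
real-valued test functions on `ℝ^d` with its canonical LF topology. -/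
noncomputable def translateTest {d : ℕ} (h : EuclideanSpace ℝ (Fin d)) :
    𝓓((⊤ : Opens (EuclideanSpace ℝ (Fin d))), ℝ) →L[ℝ]
      𝓓((⊤ : Opens (EuclideanSpace ℝ (Fin d))), ℝ) :=
  TestFunction.limitCLM ℝ
    (fun φ ↦
      { toFun := fun x ↦ φ (x - h)
        contDiff' := φ.contDiff.comp (contDiff_id.sub contDiff_const)
        hasCompactSupport' :=
          φ.hasCompactSupport.comp_homeomorph (Homeomorph.subRight h)
        tsupport_subset' := fun _ _ ↦ trivial })
    (fun K _ ↦
      TestFunction.ofSupportedInCLM ℝ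
          (K := ⟨(fun x ↦ x + h) '' (K : Set (EuclideanSpace ℝ (Fin d))),
            K.isCompact.image (by fun_prop)⟩) (fun _ _ ↦ trivial) ∘L
        ContDiffMapSupportedIn.mkCLM ℝ (fun φ x ↦ φ (x - h))
          (fun _ _ _ ↦ rfl) (fun _ _ _ ↦ rfl)
          (fun φ ↦ φ.contDiff.comp (contDiff_id.sub contDiff_const))
          (fun φ x hx ↦ φ.zero_on_compl fun hK ↦ hx ⟨x - h, hK, sub_add_cancel x h⟩)
          (fun i _ ↦ ⟨{i}, 1, zero_le_one, fun φ x _ ↦ by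
            rw [iteratedFDeriv_comp_sub, one_mul, Finset.sup_singleton]
            exact ContDiffMapSupportedIn.norm_iteratedFDeriv_apply_le_seminorm_top ℝ⟩))
    (fun _ _ _ ↦ rfl)

@[simp]
theorem translateTest_apply {d : ℕ} (h : EuclideanSpace ℝ (Fin d))
    (φ : 𝓓((⊤ : Opens (EuclideanSpace ℝ (Fin d))), ℝ)) (x : EuclideanSpace ℝ (Fin d)) :
    translateTest h φ x = φ (x - h) := rfl

/-- The translation `τ_h` on complex-valued distributions on `ℝ^d`,
`(τ_h T)(φ) = T (φ(· - h))`; on functions this is `(τ_h f)(x) = f(x + h)`. -/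
noncomputable def translateDistribution {d : ℕ} (h : EuclideanSpace ℝ (Fin d))
    (T : 𝓓'((⊤ : Opens (EuclideanSpace ℝ (Fin d))), ℂ)) :
    𝓓'((⊤ : Opens (EuclideanSpace ℝ (Fin d))), ℂ) :=
  ContinuousLinearMap.precompCompactConvergenceCLM ℂ (translateTest h) T

@[simp]
theorem translateDistribution_apply {d : ℕ} (h : EuclideanSpace ℝ (Fin d))
    (T : 𝓓'((⊤ : Opens (EuclideanSpace ℝ (Fin d))), ℂ))
    (φ : 𝓓((⊤ : Opens (EuclideanSpace ℝ (Fin d))), ℝ)) :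
    translateDistribution h T φ = T (translateTest h φ) := rfl

/-- The exponential monomial `x ↦ x ^ α * exp ⟨x, lam⟩` with `α ∈ ℕ^d`, `lam ∈ ℂ^d`, where
`⟨x, lam⟩ = ∑ j, x j * lam j`. -/
noncomputable def expMonomial {d : ℕ} (α : Fin d → ℕ) (lam : Fin d → ℂ)
    (x : EuclideanSpace ℝ (Fin d)) : ℂ :=
  (∏ j, (x j : ℂ) ^ α j) * Complex.exp (∑ j, (x j : ℂ) * lam j)

/-- (Continuous) exponential polynomials on `ℝ^d`: finite complex linear combinations of
exponential monomials. -/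
def IsExponentialPolynomial {d : ℕ} (p : EuclideanSpace ℝ (Fin d) → ℂ) : Prop :=
  p ∈ Submodule.span ℂ
    (Set.range fun q : (Fin d → ℕ) × (Fin d → ℂ) ↦ expMonomial q.1 q.2)

/-- The distribution `T` is the ordinary (locally integrable) function `g`. -/
def IsRepresentedBy {d : ℕ} (T : 𝓓'((⊤ : Opens (EuclideanSpace ℝ (Fin d))), ℂ))
    (g : EuclideanSpace ℝ (Fin d) → ℂ) : Prop :=
  LocallyIntegrable g volume ∧
    ∀ φ : 𝓓((⊤ : Opens (EuclideanSpace ℝ (Fin d))), ℝ), T φ = ∫ x, (φ x : ℂ) * g x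

end ExpPoly

/-!
Translation by `h` acts on the functions of a test function by `(τ_h u)(φ) = u(φ(· - h))`, and the
dimension hypotheses say that a nonzero polynomial in each `τ_{h i}` kills `f`. Since the `τ_{h i}`
commute, `f` lies in a finite-dimensional space `W` of distributions invariant under all of them
(`exists_finiteDimensional_invariant`).

On a finite-dimensional space an injective operator is onto, so `W` is invariant under the subgroup
generated by the `h i`. In the topology of pointwise convergence `W` is closed and
`h ↦ τ_h u` is continuous for a distribution `u`, so by density `W` is invariant under every
translation (`le_comap_translateFunctional_of_dense`). In coordinates the translations are then a
continuous representation `A` of `ℝ^d` by matrices.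

Such a representation is smooth, because convolving `A` with a bump function near the origin
multiplies it by an invertible matrix. Hence it is a product of exponentials `exp (x_i X_i)`,
and the generalized eigenspaces of the `X_i` show that its coefficients are exponential polynomials
(`isExponentialPolynomial_of_map_add`).

It remains to see that `f` is a coefficient of `A`. For a bump function `ρ` near the origin
the average `∫ ρ(h) A(h) dh` is invertible, so `f = ∫ ρ(h) τ_h T dh` for some `T` in `W`
(`exists_apply_eq_integral_smul`). As `∫ ρ(h) T(φ(· - h)) dh` is `T` applied to the convolution of
`ρ` and `φ`, it is symmetric in `ρ` and `φ` (`integral_mul_apply_translateTest_comm`):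
`f(φ) = ∫ φ(h) T(ρ(· - h)) dh`, and `h ↦ T(ρ(· - h))` is a coefficient of `A`.
Moving `T` under the integral sign uses that, on functions supported in a fixed compact set, `T` is
a continuous functional of finitely many derivatives, hence extends to a Banach space by the
Hahn-Banach theorem (`exists_eq_sum_structureMapCLM`).
-/

namespace ExpPoly

/-! ### Exponential polynomials -/

theorem IsExponentialPolynomial.expMonomial {d : ℕ} (α : Fin d → ℕ) (lam : Fin d → ℂ) :
    IsExponentialPolynomial (expMonomial α lam) :=
  Submodule.subset_span ⟨(α, lam), rfl⟩

theorem expMonomial_mul_expMonomial {d : ℕ} (α β : Fin d → ℕ) (lam mu : Fin d → ℂ) :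
    expMonomial α lam * expMonomial β mu = expMonomial (α + β) (lam + mu) := by
  ext x
  simp only [Pi.mul_apply, ExpPoly.expMonomial, Pi.add_apply, pow_add, mul_add,
    Finset.prod_mul_distrib, Finset.sum_add_distrib, Complex.exp_add]
  ring

theorem IsExponentialPolynomial.expMonomial_mul {d : ℕ} (α : Fin d → ℕ) (lam : Fin d → ℂ)
    {p : EuclideanSpace ℝ (Fin d) → ℂ} (hp : IsExponentialPolynomial p) :
    IsExponentialPolynomial (ExpPoly.expMonomial α lam * p) := by
  unfold IsExponentialPolynomial at hp ⊢
  induction hp using Submodule.span_induction with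
  | mem p hp =>
    obtain ⟨⟨β, mu⟩, rfl⟩ := hp
    rw [expMonomial_mul_expMonomial]
    exact IsExponentialPolynomial.expMonomial _ _
  | zero => simpa only [mul_zero] using Submodule.zero_mem _
  | add p q _ _ hp hq => simpa only [mul_add] using Submodule.add_mem _ hp hq
  | smul c p _ hp => simpa only [mul_smul_comm] using Submodule.smul_mem _ c hp

theorem IsExponentialPolynomial.const {d : ℕ} (c : ℂ) :
    IsExponentialPolynomial (fun _ : EuclideanSpace ℝ (Fin d) ↦ c) := by
  have h : (fun _ : EuclideanSpace ℝ (Fin d) ↦ c) = c • ExpPoly.expMonomial 0 0 := by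
    ext x
    simp [ExpPoly.expMonomial]
  rw [h]
  exact Submodule.smul_mem _ c (IsExponentialPolynomial.expMonomial 0 0)

theorem expMonomial_single {d : ℕ} (i : Fin d) (k : ℕ) (mu : ℂ) (x : EuclideanSpace ℝ (Fin d)) :
    expMonomial (Pi.single i k) (Pi.single i mu) x = (x i : ℂ) ^ k * Complex.exp (x i * mu) := by
  have h1 : ∏ j, (x j : ℂ) ^ (Pi.single i k : Fin d → ℕ) j = (x i : ℂ) ^ k := by
    rw [Finset.prod_eq_single i (fun j _ hj ↦ by simp [hj]) (by simp)]
    simp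
  have h2 : ∑ j, (x j : ℂ) * (Pi.single i mu : Fin d → ℂ) j = x i * mu := by
    rw [Finset.sum_eq_single i (fun j _ hj ↦ by simp [hj]) (by simp)]
    simp
  rw [expMonomial, h1, h2]

theorem IsExponentialPolynomial.continuous {d : ℕ} {p : EuclideanSpace ℝ (Fin d) → ℂ}
    (hp : IsExponentialPolynomial p) : Continuous p := by
  unfold IsExponentialPolynomial at hp
  induction hp using Submodule.span_induction with
  | mem p hp =>
    obtain ⟨⟨β, mu⟩, rfl⟩ := hp
    change Continuous fun x : EuclideanSpace ℝ (Fin d) ↦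
      (∏ j, (x j : ℂ) ^ β j) * Complex.exp (∑ j, (x j : ℂ) * mu j)
    fun_prop
  | zero => exact continuous_zero
  | add p q _ _ hp hq => exact hp.add hq
  | smul c p _ hp => exact hp.const_smul c

/-! ### Matrix exponentials -/

section Exponential

variable {E : Type*} [NormedAddCommGroup E] [NormedSpace ℂ E] [FiniteDimensional ℂ E]

/-- On a vector killed by a power of `X - μ`, the exponential `exp (t X)` is `exp (t μ)` times a
polynomial in `t`, because the exponential series of `t (X - μ)` terminates there. -/
theorem exp_smul_apply_of_pow_sub_smul_one_apply_eq_zero (X : E →L[ℂ] E) (mu : ℂ) (N : ℕ) (v : E)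
    (hv : ((X - mu • 1) ^ N) v = 0) (t : ℂ) :
    NormedSpace.exp (t • X) v = ∑ k ∈ Finset.range N,
      (t ^ k * Complex.exp (t * mu)) • ((k.factorial : ℂ)⁻¹ • ((X - mu • 1) ^ k) v) := by
  have : CompleteSpace E := FiniteDimensional.complete ℂ E
  let +nondep : NormedAlgebra ℚ (E →L[ℂ] E) := .restrictScalars ℚ ℂ _
  set Y : E →L[ℂ] E := X - mu • 1 with hY
  have hX : t • X = algebraMap ℂ (E →L[ℂ] E) (t * mu) + t • Y := by
    rw [hY, Algebra.algebraMap_eq_smul_one, smul_sub, smul_smul]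
    abel
  have hexp : NormedSpace.exp (t • X) = Complex.exp (t * mu) • NormedSpace.exp (t • Y) := by
    rw [hX, NormedSpace.exp_add_of_commute (Algebra.commutes _ _), ← NormedSpace.algebraMap_exp_comm,
      Algebra.algebraMap_eq_smul_one, smul_mul_assoc, one_mul, Complex.exp_eq_exp_ℂ]
  have hpow : ∀ k ∉ Finset.range N, ((k.factorial : ℂ)⁻¹ • (t • Y) ^ k) v = 0 := by
    intro k hk
    rw [Finset.mem_range, not_lt] at hk
    obtain ⟨j, rfl⟩ := Nat.exists_eq_add_of_le' hk
    rw [smul_pow, pow_add Y, smul_apply, smul_apply,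
      mul_apply_eq_comp, hv, map_zero, smul_zero, smul_zero]
  have hsum := (NormedSpace.exp_series_hasSum_exp' (𝕂 := ℂ) (t • Y)).mapL
    (ContinuousLinearMap.apply ℂ E v)
  have hfin : HasSum (fun k : ℕ ↦ ((k.factorial : ℂ)⁻¹ • (t • Y) ^ k) v) _ :=
    hasSum_sum_of_ne_finset_zero hpow
  have := hsum.unique hfin
  rw [hexp, smul_apply]
  simp only [ContinuousLinearMap.apply_apply] at this
  rw [this, Finset.smul_sum]
  refine Finset.sum_congr rfl fun k _ ↦ ?_
  simp only [smul_pow, smul_apply, smul_smul]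
  congr 1
  ring

/-- The orbit `t ↦ exp (t X) v` of a vector is a linear combination of the functions
`t ↦ t ^ k * exp (t μ)` with coefficients in `E`. -/
theorem exp_smul_apply_mem_span (X : E →L[ℂ] E) (v : E) :
    (fun t : ℂ ↦ NormedSpace.exp (t • X) v) ∈ Submodule.span ℂ
      (Set.range fun q : ℕ × ℂ × E ↦ fun t : ℂ ↦ (t ^ q.1 * Complex.exp (t * q.2.1)) • q.2.2) := by
  have hv : v ∈ ⨆ mu, Module.End.maxGenEigenspace (X : E →ₗ[ℂ] E) mu := by
    rw [Module.End.iSup_maxGenEigenspace_eq_top]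
    trivial
  refine Submodule.iSup_induction _ (motive := fun v ↦ (fun t : ℂ ↦ NormedSpace.exp (t • X) v) ∈ _)
    hv (fun mu v hv ↦ ?_) ?_ fun v w hv hw ↦ ?_
  · obtain ⟨N, hN⟩ := (Module.End.mem_maxGenEigenspace _ _ _).1 hv
    have hN' : ((X - mu • 1) ^ N) v = 0 := by
      rw [← hN]
      change _ = (((X - mu • 1 : E →L[ℂ] E) : E →ₗ[ℂ] E) ^ N) v
      rw [← ContinuousLinearMap.toLinearMap_pow]
      rfl
    have : (fun t : ℂ ↦ NormedSpace.exp (t • X) v) = ∑ k ∈ Finset.range N, fun t : ℂ ↦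
        (t ^ k * Complex.exp (t * mu)) • ((k.factorial : ℂ)⁻¹ • ((X - mu • 1) ^ k) v) := by
      ext t
      rw [exp_smul_apply_of_pow_sub_smul_one_apply_eq_zero X mu N v hN' t, Finset.sum_apply]
    rw [this]
    exact Submodule.sum_mem _ fun k _ ↦ Submodule.subset_span ⟨(k, mu, _), rfl⟩
  · simp only [map_zero]
    exact Submodule.zero_mem _
  · simp only [map_add]
    exact Submodule.add_mem _ hv hw

/-- Coefficients of a product of one-parameter groups in the separate coordinates are exponential
polynomials. The factors need not commute. -/
theorem isExponentialPolynomial_list_prod_exp {d : ℕ} (X : Fin d → E →L[ℂ] E) (ℓ : E →ₗ[ℂ] ℂ)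
    (l : List (Fin d)) (v : E) :
    IsExponentialPolynomial fun x : EuclideanSpace ℝ (Fin d) ↦
      ℓ ((l.map fun i ↦ NormedSpace.exp ((x i : ℂ) • X i)).prod v) := by
  induction l using List.reverseRecOn generalizing v with
  | nil => simpa using .const (ℓ v)
  | append_singleton l i ih =>
    simp only [List.map_append, List.map_singleton, List.prod_append, List.prod_singleton,
      mul_apply_eq_comp]
    -- The innermost factor is a combination of the functions `t ↦ (t ^ k * exp (t μ)) • w`, and the
    -- claim is linear in that function.
    suffices H : ∀ u ∈ Submodule.span ℂ (Set.range fun q : ℕ × ℂ × E ↦ fun t : ℂ ↦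
        (t ^ q.1 * Complex.exp (t * q.2.1)) • q.2.2),
        IsExponentialPolynomial fun x : EuclideanSpace ℝ (Fin d) ↦
          ℓ ((l.map fun i ↦ NormedSpace.exp ((x i : ℂ) • X i)).prod (u (x i))) from
      H _ (exp_smul_apply_mem_span (X i) v)
    intro u hu
    induction hu using Submodule.span_induction with
    | mem u hu =>
      obtain ⟨⟨k, mu, w⟩, rfl⟩ := hu
      convert (ih w).expMonomial_mul (Pi.single i k) (Pi.single i mu) using 1
      ext x
      simp only [map_smul, Pi.mul_apply, expMonomial_single, smul_eq_mul]
    | zero => simpa using .const 0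
    | add u w _ _ hu hw =>
      simp only [Pi.add_apply, map_add]
      exact Submodule.add_mem _ hu hw
    | smul c u _ hu =>
      simp only [Pi.smul_apply, map_smul]
      exact Submodule.smul_mem _ c hu

end Exponential

/-! ### Continuous representations of `ℝ^d` -/

section Representation

/-- Averaging a continuous function with value `1` at the origin against a bump function
concentrated near the origin gives an invertible element. -/
theorem exists_isUnit_integral_smul {V R : Type*} [NormedAddCommGroup V] [InnerProductSpace ℝ V]
    [FiniteDimensional ℝ V] [MeasurableSpace V] [BorelSpace V] [NormedRing R] [NormedSpace ℝ R]
    [CompleteSpace R] {A : V → R} (hA : Continuous A) (h0 : A 0 = 1) :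
    ∃ ρ : V → ℝ, ContDiff ℝ (⊤ : ℕ∞) ρ ∧ HasCompactSupport ρ ∧ IsUnit (∫ t, ρ t • A t) := by
  let φ : ℕ → ContDiffBump (0 : V) := fun n ↦
    ⟨1 / (2 * ((n : ℝ) + 1)), 1 / ((n : ℝ) + 1), by positivity, by
      apply one_div_lt_one_div_of_lt <;> nlinarith [(n.cast_nonneg : (0 : ℝ) ≤ n)]⟩
  have hφ : Filter.Tendsto (fun n ↦ (φ n).rOut) Filter.atTop (nhds 0) :=
    tendsto_one_div_add_atTop_nhds_zero_nat
  have hlim := ContDiffBump.convolution_tendsto_right_of_continuous (μ := volume) hφ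
    (hA.comp continuous_neg) 0
  simp only [Function.comp_apply, neg_zero, h0] at hlim
  obtain ⟨n, hn⟩ := (hlim.eventually (Units.isOpen.mem_nhds isUnit_one)).exists
  refine ⟨(φ n).normed volume, (φ n).contDiff_normed, (φ n).hasCompactSupport_normed, ?_⟩
  simpa [convolution] using hn

variable {E : Type*} [NormedAddCommGroup E] [NormedSpace ℂ E] [FiniteDimensional ℂ E]

/-- Every vector is an average of the vectors `A t v`, for some `v`, against a test function. -/
theorem exists_apply_eq_integral_smul {V : Type*} [NormedAddCommGroup V] [InnerProductSpace ℝ V]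
    [FiniteDimensional ℝ V] [MeasurableSpace V] [BorelSpace V] {A : V → E →L[ℂ] E}
    (hA : Continuous A) (h0 : A 0 = 1) (w : E) :
    ∃ ρ : V → ℝ, ContDiff ℝ (⊤ : ℕ∞) ρ ∧ HasCompactSupport ρ ∧ ∃ v : E, ∀ ℓ : E →ₗ[ℂ] ℂ,
      ℓ w = ∫ t, (ρ t : ℂ) * ℓ (A t v) := by
  have : CompleteSpace E := FiniteDimensional.complete ℂ E
  obtain ⟨ρ, hρ, hρc, u, hu⟩ := exists_isUnit_integral_smul hA h0
  have hint : Integrable fun t ↦ ρ t • A t :=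
    (hρ.continuous.smul hA).integrable_of_hasCompactSupport hρc.smul_right
  refine ⟨ρ, hρ, hρc, (↑u⁻¹ : E →L[ℂ] E) w, fun ℓ ↦ ?_⟩
  let L := ℓ.toContinuousLinearMap ∘L ContinuousLinearMap.apply ℂ E ((↑u⁻¹ : E →L[ℂ] E) w)
  calc ℓ w = ℓ ((↑u * ↑u⁻¹ : E →L[ℂ] E) w) := by rw [Units.mul_inv]; rfl
    _ = L (∫ t, ρ t • A t) := by rw [← hu]; rfl
    _ = ∫ t, L (ρ t • A t) := (L.integral_comp_comm hint).symm
    _ = _ := by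
      refine integral_congr_ae (.of_forall fun t ↦ ?_)
      beta_reduce
      rw [← Complex.coe_smul, map_smul, smul_eq_mul]
      rfl

/-- A continuous multiplicative map `A` is smooth: for a bump function `ρ` the average
`M = ∫ ρ(t) A(-t) dt` is invertible, and `A(x) M` is the convolution of `ρ` with `A`. -/
theorem contDiff_of_continuous_of_map_add {V : Type*} [NormedAddCommGroup V] [InnerProductSpace ℝ V]
    [FiniteDimensional ℝ V] [MeasurableSpace V] [BorelSpace V] {A : V → E →L[ℂ] E}
    (hA : Continuous A) (h0 : A 0 = 1) (hadd : ∀ x y, A (x + y) = A x * A y) :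
    ContDiff ℝ (⊤ : ℕ∞) A := by
  have : CompleteSpace E := FiniteDimensional.complete ℂ E
  obtain ⟨ρ, hρ, hρc, hM⟩ := exists_isUnit_integral_smul (hA.comp continuous_neg) (by simpa using h0)
  set M := ∫ t, ρ t • (A ∘ Neg.neg) t with hMdef
  have hconv : ∀ x, convolution ρ A (ContinuousLinearMap.lsmul ℝ ℝ) volume x = A x * M := by
    intro x
    have hint : Integrable fun t ↦ ρ t • (A ∘ Neg.neg) t :=
      (hρ.continuous.smul (hA.comp continuous_neg)).integrable_of_hasCompactSupport hρc.smul_right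
    rw [hMdef, ← integral_const_mul_of_integrable hint]
    refine integral_congr_ae (.of_forall fun t ↦ ?_)
    simp only [ContinuousLinearMap.lsmul_apply, Function.comp_apply, sub_eq_add_neg, hadd,
      mul_smul_comm]
  have hsmooth : ContDiff ℝ (⊤ : ℕ∞) fun x ↦ A x * M := by
    rw [← funext hconv]
    exact hρc.contDiff_convolution_left _ hρ hA.locallyIntegrable
  obtain ⟨u, hu⟩ := hM
  have : A = fun x ↦ ((ContinuousLinearMap.mul ℝ (E →L[ℂ] E)).flip (↑u⁻¹ : E →L[ℂ] E)) (A x * M) := by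
    ext1 x
    rw [ContinuousLinearMap.flip_apply, ContinuousLinearMap.mul_apply', mul_assoc, ← hu,
      Units.mul_inv, mul_one]
  rw [this]
  exact (ContinuousLinearMap.contDiff _).comp hsmooth

/-- A continuous one-parameter group of operators is `t ↦ exp (t X)`. -/
theorem exists_eq_exp_smul {B : ℝ → E →L[ℂ] E} (hB : Continuous B) (h0 : B 0 = 1)
    (hadd : ∀ s t, B (s + t) = B s * B t) :
    ∃ X : E →L[ℂ] E, ∀ t : ℝ, B t = NormedSpace.exp ((t : ℂ) • X) := by
  have : CompleteSpace E := FiniteDimensional.complete ℂ E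
  let +nondep : NormedAlgebra ℚ (E →L[ℂ] E) := .restrictScalars ℚ ℂ _
  have hdiff : Differentiable ℝ B :=
    (contDiff_of_continuous_of_map_add hB h0 hadd).differentiable (by simp)
  set X := deriv B 0
  have hderiv : ∀ t, HasDerivAt B (B t * X) t := by
    intro t
    have h1 : HasDerivAt (fun s ↦ B t * B (s - t)) (B t * X) t := by
      refine HasDerivAt.const_mul (B t) ?_
      refine HasDerivAt.comp_sub_const (f := B) t t ?_
      rw [sub_self]
      exact (hdiff 0).hasDerivAt
    refine h1.congr_of_eventuallyEq (.of_forall fun s ↦ ?_)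
    change B s = B t * B (s - t)
    rw [← hadd, add_sub_cancel]
  have hexp : ∀ t : ℝ, HasDerivAt (fun s : ℝ ↦ NormedSpace.exp ((s : ℂ) • -X))
      (-X * NormedSpace.exp ((t : ℂ) • -X)) t := by
    intro t
    have := HasDerivAt.scomp t (hasDerivAt_exp_smul_const' (𝕂 := ℂ) (-X) (Complex.ofRealCLM t))
      (Complex.ofRealCLM.hasDerivAt (x := t))
    simpa only [Function.comp_def, Complex.ofRealCLM_apply, Complex.ofReal_one, one_smul] using this
  have hprod : ∀ t : ℝ, HasDerivAt (fun s : ℝ ↦ B s * NormedSpace.exp ((s : ℂ) • -X)) 0 t := by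
    intro t
    refine ((hderiv t).mul (hexp t)).congr_deriv ?_
    noncomm_ring
  refine ⟨X, fun t ↦ ?_⟩
  have hconst := is_const_of_deriv_eq_zero (fun s ↦ (hprod s).differentiableAt)
    (fun s ↦ (hprod s).deriv) t 0
  simp only [Complex.ofReal_zero, zero_smul, NormedSpace.exp_zero, h0, mul_one] at hconst
  have hinv : NormedSpace.exp ((t : ℂ) • -X) * NormedSpace.exp ((t : ℂ) • X) = 1 := by
    rw [← NormedSpace.exp_add_of_commute ((Commute.refl X).neg_left.smul_left _ |>.smul_right _),
      smul_neg, neg_add_cancel, NormedSpace.exp_zero]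
  rw [← mul_one (B t), ← hinv, ← mul_assoc, hconst, one_mul]

/-- The coefficients of a continuous finite-dimensional representation of `ℝ^d` are exponential
polynomials. -/
theorem isExponentialPolynomial_of_map_add {d : ℕ} {A : EuclideanSpace ℝ (Fin d) → E →L[ℂ] E}
    (hA : Continuous A) (h0 : A 0 = 1) (hadd : ∀ x y, A (x + y) = A x * A y) (ℓ : E →ₗ[ℂ] ℂ)
    (v : E) : IsExponentialPolynomial fun x ↦ ℓ (A x v) := by
  have hX : ∀ i : Fin d, ∃ X : E →L[ℂ] E, ∀ t : ℝ,
      A (t • EuclideanSpace.single i 1) = NormedSpace.exp ((t : ℂ) • X) := fun i ↦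
    exists_eq_exp_smul (B := fun t ↦ A (t • EuclideanSpace.single i 1))
      (hA.comp (continuous_id.smul continuous_const)) (by simpa using h0)
      (fun s t ↦ by rw [add_smul, hadd])
  choose X hX using hX
  have hlist : ∀ l : List (EuclideanSpace ℝ (Fin d)), A l.sum = (l.map A).prod := by
    intro l
    induction l with
    | nil => simpa using h0
    | cons x l ih => simp [hadd, ih]
  convert isExponentialPolynomial_list_prod_exp X ℓ (List.finRange d) v using 4 with x
  have hx : x = ((List.finRange d).map fun i ↦ x i • EuclideanSpace.single i (1 : ℝ)).sum := by
    rw [← Fin.sum_univ_def]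
    simpa using ((EuclideanSpace.basisFun (Fin d) ℝ).sum_repr x).symm
  conv_lhs => rw [hx]
  simp only [hlist, List.map_map, Function.comp_def, hX]

end Representation

/-! ### Translates of a test function and the regularization of a distribution -/

/-- Translating a uniformly continuous bounded function is continuous in the sup norm. -/
theorem continuous_compContinuous_sub {V F : Type*} [SeminormedAddCommGroup V]
    [PseudoMetricSpace F] (G : BoundedContinuousFunction V F) (hG : UniformContinuous G) :
    Continuous fun h : V ↦ G.compContinuous ⟨fun x ↦ x - h, by fun_prop⟩ := by
  rw [Metric.continuous_iff]
  intro h ε hε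
  obtain ⟨δ, hδ, H⟩ := Metric.uniformContinuous_iff.1 hG (ε / 2) (half_pos hε)
  refine ⟨δ, hδ, fun k hk ↦ lt_of_le_of_lt ?_ (half_lt_self hε)⟩
  rw [BoundedContinuousFunction.dist_le (half_pos hε).le]
  intro x
  refine (H ?_).le
  change dist (x - k) (x - h) < δ
  rwa [dist_sub_left]

variable {d : ℕ}

/-- The algebraic sum of the supports of two test functions, as a compact set. -/
def supportSum (φ ψ : 𝓓((⊤ : Opens (EuclideanSpace ℝ (Fin d))), ℝ)) :
    Compacts (EuclideanSpace ℝ (Fin d)) :=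
  ⟨(fun q : EuclideanSpace ℝ (Fin d) × EuclideanSpace ℝ (Fin d) ↦ q.1 + q.2) ''
      (tsupport φ ×ˢ tsupport ψ),
    (φ.hasCompactSupport.isCompact.prod ψ.hasCompactSupport.isCompact).image (by fun_prop)⟩

theorem add_mem_supportSum {φ ψ : 𝓓((⊤ : Opens (EuclideanSpace ℝ (Fin d))), ℝ)}
    {x y : EuclideanSpace ℝ (Fin d)} (hx : φ x ≠ 0) (hy : ψ y ≠ 0) :
    x + y ∈ supportSum φ ψ :=
  ⟨(x, y), ⟨subset_tsupport _ hx, subset_tsupport _ hy⟩, rfl⟩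

/-- The function `x ↦ ψ(h) φ(x - h)`. Its support lies in a compact set that does not depend
on `h`. -/
noncomputable def smulTranslate (φ ψ : 𝓓((⊤ : Opens (EuclideanSpace ℝ (Fin d))), ℝ))
    (h : EuclideanSpace ℝ (Fin d)) :
    𝓓_{supportSum φ ψ}(EuclideanSpace ℝ (Fin d), ℝ) :=
  .of_support_subset (f := fun x ↦ ψ h • φ (x - h))
    ((φ.contDiff.comp (contDiff_id.sub contDiff_const)).const_smul _) fun x hx ↦ by
      have hx' : ψ h * φ (x - h) ≠ 0 := hx
      simpa using add_mem_supportSum (right_ne_zero_of_mul hx') (left_ne_zero_of_mul hx')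

theorem ofSupportedIn_smulTranslate (φ ψ : 𝓓((⊤ : Opens (EuclideanSpace ℝ (Fin d))), ℝ))
    (h : EuclideanSpace ℝ (Fin d)) :
    TestFunction.ofSupportedIn (Ω := ⊤) (fun _ _ ↦ trivial) (smulTranslate φ ψ h) =
      ψ h • translateTest h φ := by
  ext x
  rfl

theorem iteratedFDeriv_smulTranslate (φ ψ : 𝓓((⊤ : Opens (EuclideanSpace ℝ (Fin d))), ℝ))
    (i : ℕ) (h x : EuclideanSpace ℝ (Fin d)) :
    iteratedFDeriv ℝ i (smulTranslate φ ψ h) x = ψ h • iteratedFDeriv ℝ i φ (x - h) := by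
  have hφ : ContDiff ℝ i fun x ↦ φ (x - h) :=
    (φ.contDiff.comp (contDiff_id.sub contDiff_const)).of_le (by exact_mod_cast le_top)
  have := iteratedFDeriv_const_smul_apply (𝕜 := ℝ) (a := ψ h) (hφ.contDiffAt (x := x))
  rw [iteratedFDeriv_comp_sub] at this
  exact this

theorem continuous_smulTranslate (φ ψ : 𝓓((⊤ : Opens (EuclideanSpace ℝ (Fin d))), ℝ)) :
    Continuous (smulTranslate φ ψ) := by
  rw [ContDiffMapSupportedIn.continuous_iff_comp]
  intro i
  have hcont : Continuous (iteratedFDeriv ℝ i φ) :=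
    φ.contDiff.continuous_iteratedFDeriv (by exact_mod_cast le_top)
  have hcpt : HasCompactSupport (iteratedFDeriv ℝ i φ) := φ.hasCompactSupport.iteratedFDeriv i
  obtain ⟨C, hC⟩ := hcont.bounded_above_of_compact_support hcpt
  let G := BoundedContinuousFunction.ofNormedAddCommGroup (iteratedFDeriv ℝ i φ) hcont C hC
  have hG : UniformContinuous G := hcpt.uniformContinuous_of_continuous hcont
  refine (ψ.continuous.smul (continuous_compContinuous_sub G hG)).congr fun h ↦ ?_
  ext1 x
  rw [Function.comp_apply, ContDiffMapSupportedIn.structureMapCLM_top_apply,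
    iteratedFDeriv_smulTranslate]
  rfl

/-- `h ↦ T(φ(· - h))` is continuous for every distribution `T` and test function `φ`. -/
theorem continuous_apply_translateTest (T : 𝓓'((⊤ : Opens (EuclideanSpace ℝ (Fin d))), ℂ))
    (φ : 𝓓((⊤ : Opens (EuclideanSpace ℝ (Fin d))), ℝ)) :
    Continuous fun h ↦ T (translateTest h φ) := by
  rw [continuous_iff_continuousAt]
  intro h₀
  -- Near `h₀` the translates may be multiplied by a cutoff in `h`, so that all of them are
  -- supported in one compact set.
  let χ : ContDiffBump h₀ := ⟨1, 2, one_pos, one_lt_two⟩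
  let ψ : 𝓓((⊤ : Opens (EuclideanSpace ℝ (Fin d))), ℝ) :=
    ⟨χ, χ.contDiff, χ.hasCompactSupport, fun _ _ ↦ trivial⟩
  have hcont : Continuous fun h ↦ T (TestFunction.ofSupportedIn (fun _ _ ↦ trivial)
      (smulTranslate φ ψ h)) :=
    T.continuous.comp ((TestFunction.continuous_ofSupportedIn _).comp
      (continuous_smulTranslate φ ψ))
  refine hcont.continuousAt.congr ?_
  filter_upwards [χ.eventuallyEq_one] with h hh
  have hψ : ψ h = 1 := hh
  rw [ofSupportedIn_smulTranslate, hψ, one_smul]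

/-- The derivatives of a convolution fall on the smooth compactly supported factor. -/
theorem iteratedFDeriv_convolution {V F : Type*} [NormedAddCommGroup V] [NormedSpace ℝ V]
    [FiniteDimensional ℝ V] [MeasurableSpace V] [BorelSpace V] [NormedAddCommGroup F]
    [NormedSpace ℝ F] (μ : Measure V) [SFinite μ] [μ.IsAddLeftInvariant] {ψ : V → ℝ}
    (hψ : LocallyIntegrable ψ μ) {φ : V → F} (hφ : ContDiff ℝ (⊤ : ℕ∞) φ)
    (hφc : HasCompactSupport φ) (i : ℕ) :
    iteratedFDeriv ℝ i (fun x ↦ ∫ h, ψ h • φ (x - h) ∂μ) =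
      fun x ↦ ∫ h, ψ h • iteratedFDeriv ℝ i φ (x - h) ∂μ := by
  induction i with
  | zero =>
    ext1 x
    simp only [iteratedFDeriv_zero_eq_comp, Function.comp_apply]
    refine ((continuousMultilinearCurryFin0 ℝ V F).symm.toContinuousLinearEquiv.integral_comp_comm
      (𝕜 := ℝ) _).symm.trans (integral_congr_ae (.of_forall fun h ↦ ?_))
    exact map_smul (continuousMultilinearCurryFin0 ℝ V F).symm _ _
  | succ i ih =>
    have hi : ContDiff ℝ 1 (iteratedFDeriv ℝ i φ) :=
      hφ.iteratedFDeriv_right (by exact_mod_cast le_top)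
    ext1 x
    have h1 := ((hφc.iteratedFDeriv i).hasFDerivAt_convolution_right (μ := μ)
      (ContinuousLinearMap.lsmul ℝ ℝ) hψ hi x).fderiv
    simp only [iteratedFDeriv_succ_eq_comp_left, Function.comp_apply, ih]
    let e : (V →L[ℝ] V [×i]→L[ℝ] F) ≃L[ℝ] (V [×(i + 1)]→L[ℝ] F) :=
      (continuousMultilinearCurryLeftEquiv ℝ (fun _ : Fin (i + 1) ↦ V) F).symm.toContinuousLinearEquiv
    refine (congrArg e h1).trans ?_
    refine (ContinuousLinearEquiv.integral_comp_comm (𝕜 := ℝ)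
      (E := V →L[ℝ] V [×i]→L[ℝ] F) (F := V [×(i + 1)]→L[ℝ] F) e
      (fun h ↦ ψ h • fderiv ℝ (iteratedFDeriv ℝ i φ) (x - h)) (μ := μ)).symm.trans
      (integral_congr_ae (.of_forall fun h ↦ ?_))
    exact map_smul e _ _

/-- A linear map into a finite-dimensional space that is bounded by `C * ‖J φ‖` factors
continuously through `J`. -/
theorem exists_eq_comp_of_norm_le {D B F : Type*} [AddCommGroup D] [Module ℝ D]
    [NormedAddCommGroup B] [NormedSpace ℝ B] [NormedAddCommGroup F] [NormedSpace ℝ F]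
    [FiniteDimensional ℝ F] (J : D →ₗ[ℝ] B) (T : D →ₗ[ℝ] F) (C : ℝ)
    (hT : ∀ φ, ‖T φ‖ ≤ C * ‖J φ‖) : ∃ G : B →L[ℝ] F, ∀ φ, T φ = G (J φ) := by
  have hker : J.ker ≤ T.ker := fun φ hφ ↦ by
    have := hT φ
    rw [LinearMap.mem_ker.1 hφ, norm_zero, mul_zero] at this
    exact norm_le_zero_iff.1 this
  let g : J.range →ₗ[ℝ] F := (J.ker.liftQ T hker).comp J.quotKerEquivRange.symm.toLinearMap
  have hg : ∀ φ, g ⟨J φ, φ, rfl⟩ = T φ := fun φ ↦ by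
    simp only [g, LinearMap.comp_apply, LinearEquiv.coe_coe]
    rw [LinearMap.quotKerEquivRange_symm_apply_image J φ ⟨φ, rfl⟩]
    rfl
  let g' : J.range →L[ℝ] F := g.mkContinuous C fun y ↦ by
    obtain ⟨_, φ, rfl⟩ := y
    rw [hg]
    exact hT φ
  obtain ⟨G, hG⟩ := g'.exist_extension_of_finiteDimensional_range
  refine ⟨G, fun φ ↦ ?_⟩
  rw [← hg φ]
  exact DFunLike.congr_fun hG ⟨J φ, φ, rfl⟩

/-- A linear map controlled by finitely many linear maps `J i` is a sum of continuous linear maps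
composed with the `J i`. -/
theorem exists_eq_sum_of_norm_le {ι D F : Type*} [Fintype ι] [DecidableEq ι] {B : ι → Type*}
    [AddCommGroup D] [Module ℝ D] [∀ i, NormedAddCommGroup (B i)] [∀ i, NormedSpace ℝ (B i)]
    [NormedAddCommGroup F] [NormedSpace ℝ F] [FiniteDimensional ℝ F] (J : ∀ i, D →ₗ[ℝ] B i)
    (T : D →ₗ[ℝ] F) (C : ℝ) (hT : ∀ φ r, 0 ≤ r → (∀ i, ‖J i φ‖ ≤ r) → ‖T φ‖ ≤ C * r) :
    ∃ G : ∀ i, B i →L[ℝ] F, ∀ φ, T φ = ∑ i, G i (J i φ) := by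
  obtain ⟨G, hG⟩ := exists_eq_comp_of_norm_le (LinearMap.pi J) T C fun φ ↦
    hT φ _ (norm_nonneg _) fun i ↦ norm_le_pi_norm (LinearMap.pi J φ) i
  refine ⟨fun i ↦ G ∘L ContinuousLinearMap.single ℝ B i, fun φ ↦ ?_⟩
  rw [hG, ← LinearMap.sum_single_apply B (LinearMap.pi J φ), map_sum]
  rfl

/-- On smooth functions supported in a fixed compact set, a continuous linear functional is a sum
of continuous functionals of finitely many derivatives, which are measured in the sup norm. -/
theorem exists_eq_sum_structureMapCLM {V : Type*} [NormedAddCommGroup V] [NormedSpace ℝ V]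
    {K : Compacts V} (T : 𝓓_{K}(V, ℝ) →L[ℝ] ℂ) :
    ∃ (s : Finset ℕ) (G : ∀ i : s, BoundedContinuousFunction V (V [×i]→L[ℝ] ℝ) →L[ℝ] ℂ),
      ∀ φ, T φ = ∑ i, G i (ContDiffMapSupportedIn.structureMapCLM ℝ ⊤ i φ) := by
  obtain ⟨s, C, -, hC⟩ := Seminorm.bound_of_continuous
    (ContDiffMapSupportedIn.withSeminorms ℝ V ℝ ⊤ K)
    ((normSeminorm ℝ ℂ).comp T.toLinearMap) T.continuous.norm
  obtain ⟨G, hG⟩ := exists_eq_sum_of_norm_le (ι := s)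
    (B := fun i ↦ BoundedContinuousFunction V (V [×i]→L[ℝ] ℝ))
    (fun i ↦ (ContDiffMapSupportedIn.structureMapCLM ℝ ⊤ i).toLinearMap)
    T.toLinearMap C fun φ r hr hφ ↦ by
      refine (hC φ).trans ?_
      rw [smul_apply]
      exact mul_le_mul_of_nonneg_left
        (Seminorm.finset_sup_apply_le hr fun i hi ↦ hφ ⟨i, hi⟩) C.2
  exact ⟨s, G, hG⟩

variable {d : ℕ}

/-- The convolution `x ↦ ∫ ψ(h) φ(x - h) dh` of two test functions. -/
noncomputable def testConvolution (φ ψ : 𝓓((⊤ : Opens (EuclideanSpace ℝ (Fin d))), ℝ)) :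
    𝓓_{supportSum φ ψ}(EuclideanSpace ℝ (Fin d), ℝ) :=
  .of_support_subset (f := fun x ↦ ∫ h, ψ h • φ (x - h))
    (φ.hasCompactSupport.contDiff_convolution_right (ContinuousLinearMap.lsmul ℝ ℝ)
      ψ.continuous.locallyIntegrable φ.contDiff) fun x hx ↦ by
      by_contra hK
      refine hx (integral_eq_zero_of_ae (.of_forall fun h ↦ ?_))
      exact (smulTranslate φ ψ h).zero_on_compl hK

theorem testConvolution_comm (φ ψ : 𝓓((⊤ : Opens (EuclideanSpace ℝ (Fin d))), ℝ)) :
    TestFunction.ofSupportedIn (Ω := ⊤) (fun _ _ ↦ trivial) (testConvolution φ ψ) =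
      TestFunction.ofSupportedIn (Ω := ⊤) (fun _ _ ↦ trivial) (testConvolution ψ φ) := by
  ext x
  change ∫ h, ψ h • φ (x - h) = ∫ h, φ h • ψ (x - h)
  rw [← integral_sub_left_eq_self _ volume x]
  simp only [sub_sub_cancel, smul_eq_mul, mul_comm]

/-- A continuous functional on bounded continuous functions commutes with the average of the
functions `H h = ψ(h) g(· - h)`. -/
theorem integrable_and_integral_apply_eq {V F : Type*} [NormedAddCommGroup V] [NormedSpace ℝ V]
    [FiniteDimensional ℝ V] [MeasurableSpace V] [BorelSpace V] [NormedAddCommGroup F]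
    [NormedSpace ℝ F] [CompleteSpace F] (μ : Measure V) [IsFiniteMeasureOnCompacts μ]
    {ψ : V → ℝ} (hψc : HasCompactSupport ψ)
    {H : V → BoundedContinuousFunction V F} (hH : Continuous H) {g : V → F}
    (hHg : ∀ h x, H h x = ψ h • g (x - h)) {U : BoundedContinuousFunction V F}
    (hU : ∀ x, U x = ∫ h, ψ h • g (x - h) ∂μ)
    (L : BoundedContinuousFunction V F →L[ℝ] ℂ) :
    Integrable (fun h ↦ L (H h)) μ ∧ ∫ h, L (H h) ∂μ = L U := by
  have hHc : HasCompactSupport H := .intro hψc.isCompact fun h hh ↦ by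
    ext1 x
    rw [hHg, image_eq_zero_of_notMem_tsupport hh, zero_smul]
    rfl
  have hHi : Integrable H μ := hH.integrable_of_hasCompactSupport hHc
  have hint : ∫ h, H h ∂μ = U := by
    ext1 x
    rw [← BoundedContinuousFunction.evalCLM_apply (𝕜 := ℝ),
      ← ContinuousLinearMap.integral_comp_comm _ hHi, hU]
    simp only [BoundedContinuousFunction.evalCLM_apply, hHg]
  exact ⟨L.integrable_comp hHi, by rw [L.integral_comp_comm hHi, hint]⟩

/-- A distribution applied to a convolution may be moved under the integral sign. -/
theorem apply_testConvolution (T : 𝓓'((⊤ : Opens (EuclideanSpace ℝ (Fin d))), ℂ))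
    (φ ψ : 𝓓((⊤ : Opens (EuclideanSpace ℝ (Fin d))), ℝ)) :
    T (TestFunction.ofSupportedIn (fun _ _ ↦ trivial) (testConvolution φ ψ)) =
      ∫ h, (ψ h : ℂ) * T (translateTest h φ) := by
  let T' : 𝓓_{supportSum φ ψ}(EuclideanSpace ℝ (Fin d), ℝ) →L[ℝ] ℂ :=
    (show 𝓓((⊤ : Opens (EuclideanSpace ℝ (Fin d))), ℝ) →L[ℝ] ℂ from T) ∘L
      TestFunction.ofSupportedInCLM ℝ (fun _ _ ↦ trivial)
  obtain ⟨s, G, hG⟩ := exists_eq_sum_structureMapCLM T'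
  have hint (i : s) := integrable_and_integral_apply_eq (V := EuclideanSpace ℝ (Fin d))
    (F := EuclideanSpace ℝ (Fin d) [×i]→L[ℝ] ℝ) volume ψ.hasCompactSupport
    (H := fun h ↦ ContDiffMapSupportedIn.structureMapCLM ℝ ⊤ i (smulTranslate φ ψ h))
    ((ContDiffMapSupportedIn.structureMapCLM ℝ ⊤ i).continuous.comp
      (continuous_smulTranslate φ ψ))
    (g := iteratedFDeriv ℝ i φ)
    (fun h x ↦ by
      rw [ContDiffMapSupportedIn.structureMapCLM_top_apply, iteratedFDeriv_smulTranslate])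
    (U := ContDiffMapSupportedIn.structureMapCLM ℝ ⊤ i (testConvolution φ ψ))
    (fun x ↦ by
      rw [ContDiffMapSupportedIn.structureMapCLM_top_apply]
      exact congrFun (iteratedFDeriv_convolution volume
        ψ.continuous.locallyIntegrable φ.contDiff φ.hasCompactSupport i) x) (G i)
  calc T (TestFunction.ofSupportedIn (fun _ _ ↦ trivial) (testConvolution φ ψ))
      = ∑ i, G i (ContDiffMapSupportedIn.structureMapCLM ℝ ⊤ i (testConvolution φ ψ)) := hG _
    _ = ∑ i, ∫ h, G i (ContDiffMapSupportedIn.structureMapCLM ℝ ⊤ i (smulTranslate φ ψ h)) :=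
      Finset.sum_congr rfl fun i _ ↦ (hint i).2.symm
    _ = ∫ h, ∑ i, G i (ContDiffMapSupportedIn.structureMapCLM ℝ ⊤ i (smulTranslate φ ψ h)) :=
      (integral_finsetSum _ fun i _ ↦ (hint i).1).symm
    _ = ∫ h, (ψ h : ℂ) * T (translateTest h φ) := by
      refine integral_congr_ae (.of_forall fun h ↦ ?_)
      have h2 : T' (smulTranslate φ ψ h) = T (ψ h • translateTest h φ) :=
        congrArg T (ofSupportedIn_smulTranslate φ ψ h)
      beta_reduce
      rw [← hG, h2, map_smul, Complex.real_smul]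

/-- Averaging the translates of `T` against `ψ` is symmetric in `φ` and `ψ`. -/
theorem integral_mul_apply_translateTest_comm
    (T : 𝓓'((⊤ : Opens (EuclideanSpace ℝ (Fin d))), ℂ))
    (φ ψ : 𝓓((⊤ : Opens (EuclideanSpace ℝ (Fin d))), ℝ)) :
    ∫ h, (ψ h : ℂ) * T (translateTest h φ) = ∫ h, (φ h : ℂ) * T (translateTest h ψ) := by
  rw [← apply_testConvolution, ← apply_testConvolution, testConvolution_comm]

/-! ### Finite-dimensional invariant subspaces -/

section Invariant

variable {K M ι : Type*} [Field K] [AddCommGroup M] [Module K M]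

/-- If a nonzero polynomial in `T` kills a finite-dimensional subspace `U`, then the span of the
subspaces `T ^ j U` is already spanned by those with `j` less than the degree. -/
theorem exists_finiteDimensional_le_comap (T : Module.End K M) {P : Polynomial K} (hP : P ≠ 0)
    (U : Submodule K M) [FiniteDimensional K U] (hU : ∀ u ∈ U, Polynomial.aeval T P u = 0) :
    ∃ N : ℕ, (⨆ j : Fin N, U.map (T ^ (j : ℕ))) ≤ (⨆ j : Fin N, U.map (T ^ (j : ℕ))).comap T ∧
      U ≤ ⨆ j : Fin N, U.map (T ^ (j : ℕ)) := by
  by_cases hN : P.natDegree = 0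
  · have hU0 : U = ⊥ := by
      rw [Polynomial.eq_C_of_natDegree_eq_zero hN] at hU hP
      refine (Submodule.eq_bot_iff _).2 fun u hu ↦ ?_
      have := hU u hu
      rw [Polynomial.aeval_C, Module.algebraMap_end_apply] at this
      exact (smul_eq_zero.1 this).resolve_left fun h ↦ hP (by rw [h, map_zero])
    exact ⟨0, by simp, by simp [hU0]⟩
  have hmem : ∀ j < P.natDegree, ∀ u ∈ U, (T ^ j) u ∈
      ⨆ j : Fin P.natDegree, U.map (T ^ (j : ℕ)) := fun j hj u hu ↦
    Submodule.mem_iSup_of_mem (⟨j, hj⟩ : Fin P.natDegree) (Submodule.mem_map_of_mem hu)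
  refine ⟨P.natDegree, iSup_le fun j ↦ ?_, fun u hu ↦ hmem 0 (Nat.pos_of_ne_zero hN) u hu⟩
  rintro _ ⟨u, hu, rfl⟩
  rw [Submodule.mem_comap, ← Module.End.mul_apply, ← pow_succ']
  rcases (Nat.succ_le_of_lt j.2).lt_or_eq with hj | hj
  · exact hmem _ hj u hu
  · have h0 := hU u hu
    rw [Polynomial.aeval_eq_sum_range, LinearMap.sum_apply, Finset.sum_range_succ] at h0
    have hlc : P.coeff P.natDegree ≠ 0 := Polynomial.leadingCoeff_ne_zero.2 hP
    rw [← Nat.succ_eq_add_one, hj, ← Submodule.smul_mem_iff _ hlc, ← LinearMap.smul_apply,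
      eq_neg_of_add_eq_zero_right h0]
    refine Submodule.neg_mem _ (Submodule.sum_mem _ fun k hk ↦ ?_)
    exact Submodule.smul_mem _ _ (hmem k (Finset.mem_range.1 hk) u hu)

/-- If each of finitely many commuting operators satisfies a nonzero polynomial equation at `f`,
then `f` lies in a finite-dimensional subspace invariant under all of them. -/
theorem exists_finiteDimensional_invariant (T : ι → Module.End K M)
    (hT : ∀ i j, Commute (T i) (T j)) (P : ι → Polynomial K) (hP : ∀ i, P i ≠ 0) (f : M)
    (hf : ∀ i, Polynomial.aeval (T i) (P i) f = 0) (s : Finset ι) :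
    ∃ U : Submodule K M, FiniteDimensional K U ∧ f ∈ U ∧ (∀ i ∈ s, U ≤ U.comap (T i)) ∧
      ∀ i, ∀ u ∈ U, Polynomial.aeval (T i) (P i) u = 0 := by
  classical
  induction s using Finset.induction_on with
  | empty =>
    refine ⟨K ∙ f, inferInstance, Submodule.mem_span_singleton_self f, by simp, fun i u hu ↦ ?_⟩
    obtain ⟨c, rfl⟩ := Submodule.mem_span_singleton.1 hu
    rw [map_smul, hf, smul_zero]
  | insert i s _ ih =>
    obtain ⟨U, hfin, hfU, hs, hU⟩ := ih
    obtain ⟨N, hinv, hle⟩ := exists_finiteDimensional_le_comap (T i) (hP i) U (hU i)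
    refine ⟨_, inferInstance, hle hfU, fun j hj ↦ ?_, fun j ↦ ?_⟩
    · rcases Finset.mem_insert.1 hj with rfl | hj
      · exact hinv
      · refine iSup_le fun k ↦ ?_
        rintro _ ⟨u, hu, rfl⟩
        rw [Submodule.mem_comap, ← Module.End.mul_apply, ((hT j i).pow_right k).eq]
        exact Submodule.mem_iSup_of_mem k (Submodule.mem_map_of_mem (hs j hj hu))
    · change (⨆ k : Fin N, U.map (T i ^ (k : ℕ))) ≤ (Polynomial.aeval (T j) (P j)).ker
      refine iSup_le fun k ↦ ?_
      rintro _ ⟨u, hu, rfl⟩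
      have hcomm : Commute (Polynomial.aeval (T j) (P j)) (T i ^ (k : ℕ)) := by
        rw [Polynomial.aeval_eq_sum_range]
        exact Commute.sum_left _ _ _ fun m _ ↦ (((hT j i).pow_pow m k).smul_left _)
      rw [LinearMap.mem_ker, ← Module.End.mul_apply, hcomm.eq, Module.End.mul_apply, hU j u hu,
        map_zero]

/-- If `f, T f, …, T ^ n f` span a space of dimension at most `n`, then a nonzero polynomial in
`T` kills `f`. -/
theorem exists_aeval_eq_zero_of_rank_span_le (T : Module.End K M) (f : M) (n : ℕ)
    (h : Module.rank K (Submodule.span K {g | ∃ k : ℕ, k ≤ n ∧ g = (T ^ k) f}) ≤ n) :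
    ∃ P : Polynomial K, P ≠ 0 ∧ Polynomial.aeval T P f = 0 := by
  have hset : {g | ∃ k : ℕ, k ≤ n ∧ g = (T ^ k) f} =
      Set.range fun k : Fin (n + 1) ↦ (T ^ (k : ℕ)) f := by
    ext g
    constructor
    · rintro ⟨k, hk, rfl⟩
      exact ⟨⟨k, Nat.lt_succ_of_le hk⟩, rfl⟩
    · rintro ⟨k, rfl⟩
      exact ⟨k, Nat.le_of_lt_succ k.2, rfl⟩
  have hdep : ¬ LinearIndependent K fun k : Fin (n + 1) ↦ (T ^ (k : ℕ)) f := fun hli ↦ by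
    have hle := Module.finrank_le_of_rank_le h
    rw [hset, finrank_span_eq_card hli, Fintype.card_fin] at hle
    exact absurd hle (Nat.not_succ_le_self n)
  obtain ⟨c, hc, k, hk⟩ := Fintype.not_linearIndependent_iff.1 hdep
  refine ⟨∑ j : Fin (n + 1), Polynomial.monomial (j : ℕ) (c j), fun h0 ↦ hk ?_, ?_⟩
  · have := congrArg (fun P ↦ Polynomial.coeff P k) h0
    simpa [Polynomial.finsetSum_coeff, Polynomial.coeff_monomial, Fin.val_inj] using this
  · simpa [map_sum, Polynomial.aeval_monomial, LinearMap.sum_apply] using hc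

end Invariant

/-! ### Translation-invariant spaces of distributions -/

section TranslationInvariant

variable {d : ℕ}

/-- Translation on arbitrary complex-valued functions of a test function. These functions carry the
topology of pointwise convergence, in which translates depend continuously on the shift. -/
noncomputable def translateFunctional (h : EuclideanSpace ℝ (Fin d)) :
    Module.End ℂ (𝓓((⊤ : Opens (EuclideanSpace ℝ (Fin d))), ℝ) → ℂ) :=
  LinearMap.funLeft ℂ ℂ (translateTest h)

theorem translateFunctional_apply (h : EuclideanSpace ℝ (Fin d))
    (u : 𝓓((⊤ : Opens (EuclideanSpace ℝ (Fin d))), ℝ) → ℂ)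
    (φ : 𝓓((⊤ : Opens (EuclideanSpace ℝ (Fin d))), ℝ)) :
    translateFunctional h u φ = u (translateTest h φ) := rfl

theorem translateFunctional_zero :
    translateFunctional (0 : EuclideanSpace ℝ (Fin d)) = 1 := by
  ext u φ
  rw [translateFunctional_apply]
  exact congrArg u (TestFunction.ext fun x ↦ by rw [translateTest_apply, sub_zero])

theorem translateFunctional_add (h k : EuclideanSpace ℝ (Fin d)) :
    translateFunctional (h + k) = translateFunctional h * translateFunctional k := by
  ext u φ
  rw [Module.End.mul_apply]
  simp only [translateFunctional_apply]
  exact congrArg u (TestFunction.ext fun x ↦ by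
    simp only [translateTest_apply, sub_sub, add_comm])

/-- The inclusion of distributions into the functions on test functions. -/
noncomputable def toFunctional (d : ℕ) :
    𝓓'((⊤ : Opens (EuclideanSpace ℝ (Fin d))), ℂ) →ₗ[ℂ]
      (𝓓((⊤ : Opens (EuclideanSpace ℝ (Fin d))), ℝ) → ℂ) where
  toFun T := T
  map_add' _ _ := rfl
  map_smul' _ _ := rfl

theorem toFunctional_apply (T : 𝓓'((⊤ : Opens (EuclideanSpace ℝ (Fin d))), ℂ))
    (φ : 𝓓((⊤ : Opens (EuclideanSpace ℝ (Fin d))), ℝ)) : toFunctional d T φ = T φ := rfl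

theorem continuous_translateFunctional_apply
    {u : 𝓓((⊤ : Opens (EuclideanSpace ℝ (Fin d))), ℝ) → ℂ}
    (hu : u ∈ (toFunctional d).range) : Continuous fun h ↦ translateFunctional h u := by
  obtain ⟨T, rfl⟩ := hu
  exact continuous_pi fun φ ↦ continuous_apply_translateTest T φ

/-- Invariance of a finite-dimensional space of distributions under a set of translations that
generates a dense subgroup extends to all translations. -/
theorem le_comap_translateFunctional_of_dense
    (W : Submodule ℂ (𝓓((⊤ : Opens (EuclideanSpace ℝ (Fin d))), ℝ) → ℂ)) [FiniteDimensional ℂ W]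
    (hW : W ≤ (toFunctional d).range) {S : Set (EuclideanSpace ℝ (Fin d))}
    (hS : Dense (AddSubgroup.closure S : Set (EuclideanSpace ℝ (Fin d))))
    (hinv : ∀ h ∈ S, W ≤ W.comap (translateFunctional h)) (h : EuclideanSpace ℝ (Fin d)) :
    W ≤ W.comap (translateFunctional h) := by
  have hgroup : ∀ k ∈ AddSubgroup.closure S, W ≤ W.comap (translateFunctional k) := by
    intro k hk
    induction hk using AddSubgroup.closure_induction with
    | mem k hk => exact hinv k hk
    | zero =>
      rw [translateFunctional_zero]
      exact fun _ hw ↦ hw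
    | add k l _ _ hk hl =>
      intro w hw
      rw [Submodule.mem_comap, translateFunctional_add]
      exact hk (hl hw)
    | neg k _ hk =>
      -- An injective operator that maps `W` into itself maps it onto itself.
      have hleft : ∀ w, translateFunctional (-k) (translateFunctional k w) = w := fun w ↦ by
        rw [← Module.End.mul_apply, ← translateFunctional_add, neg_add_cancel,
          translateFunctional_zero, Module.End.one_apply]
      have hinj : Function.Injective ((translateFunctional k).restrict hk) := fun v w hvw ↦ by
        have := congrArg (fun u : W ↦ translateFunctional (-k) u) hvw
        simp only [LinearMap.coe_restrict_apply, hleft] at this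
        exact Subtype.ext this
      intro w hw
      obtain ⟨v, hv⟩ := LinearMap.injective_iff_surjective.1 hinj ⟨w, hw⟩
      have hv' : translateFunctional k v = w := congrArg Subtype.val hv
      rw [Submodule.mem_comap, ← hv', hleft]
      exact v.2
  intro w hw
  have hclosed : IsClosed {k | translateFunctional k w ∈ W} :=
    (Submodule.closed_of_finiteDimensional W).preimage
      (continuous_translateFunctional_apply (hW hw))
  exact hclosed.closure_subset_iff.2 (fun k hk ↦ hgroup k hk hw) (hS h)

/-- In coordinates, the translations of a finite-dimensional invariant space of distributions form
a continuous representation of `ℝ^d`. -/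
theorem exists_continuous_representation
    (W : Submodule ℂ (𝓓((⊤ : Opens (EuclideanSpace ℝ (Fin d))), ℝ) → ℂ)) [FiniteDimensional ℂ W]
    (hW : W ≤ (toFunctional d).range) (hinv : ∀ h, W ≤ W.comap (translateFunctional h)) :
    ∃ (m : ℕ) (e : W ≃ₗ[ℂ] (Fin m → ℂ))
      (A : EuclideanSpace ℝ (Fin d) → (Fin m → ℂ) →L[ℂ] (Fin m → ℂ)),
      Continuous A ∧ A 0 = 1 ∧ (∀ h k, A (h + k) = A h * A k) ∧
      ∀ h v, (e.symm (A h v) : W).1 = translateFunctional h (e.symm v).1 := by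
  let e : W ≃ₗ[ℂ] (Fin (Module.finrank ℂ W) → ℂ) := (Module.finBasis ℂ W).equivFun
  let A : EuclideanSpace ℝ (Fin d) →
      (Fin (Module.finrank ℂ W) → ℂ) →L[ℂ] (Fin (Module.finrank ℂ W) → ℂ) := fun h ↦
    (e.toLinearMap ∘ₗ (translateFunctional h).restrict (hinv h) ∘ₗ
      e.symm.toLinearMap).toContinuousLinearMap
  have hAapply : ∀ h v, A h v = e ⟨translateFunctional h (e.symm v).1, hinv h (e.symm v).2⟩ :=
    fun _ _ ↦ rfl
  have hcoe : ∀ h v, (e.symm (A h v) : W).1 = translateFunctional h (e.symm v).1 := fun h v ↦ by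
    rw [hAapply, e.symm_apply_apply]
  refine ⟨_, e, A, continuous_clm_apply.2 fun v ↦ ?_, ?_, fun h k ↦ ?_, hcoe⟩
  · have he : Continuous e := e.toLinearMap.continuous_of_finiteDimensional
    exact he.comp ((continuous_translateFunctional_apply (hW (e.symm v).2)).subtype_mk _)
  · refine ContinuousLinearMap.ext fun v ↦ e.symm.injective (Subtype.ext ?_)
    rw [hcoe, translateFunctional_zero]
    rfl
  · refine ContinuousLinearMap.ext fun v ↦ e.symm.injective (Subtype.ext ?_)
    rw [mul_apply_eq_comp, hcoe, hcoe, hcoe, translateFunctional_add, Module.End.mul_apply]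

/-- A distribution in a finite-dimensional translation-invariant space is an exponential
polynomial. -/
theorem exists_isExponentialPolynomial_of_invariant
    (W : Submodule ℂ (𝓓((⊤ : Opens (EuclideanSpace ℝ (Fin d))), ℝ) → ℂ)) [FiniteDimensional ℂ W]
    (hW : W ≤ (toFunctional d).range) (hinv : ∀ h, W ≤ W.comap (translateFunctional h))
    (f : 𝓓'((⊤ : Opens (EuclideanSpace ℝ (Fin d))), ℂ)) (hf : toFunctional d f ∈ W) :
    ∃ p : EuclideanSpace ℝ (Fin d) → ℂ, IsExponentialPolynomial p ∧
      ∀ φ : 𝓓((⊤ : Opens (EuclideanSpace ℝ (Fin d))), ℝ), f φ = ∫ x, (φ x : ℂ) * p x := by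
  obtain ⟨m, e, A, hA, h0, hadd, hcoe⟩ := exists_continuous_representation W hW hinv
  have hℓ : ∀ φ : 𝓓((⊤ : Opens (EuclideanSpace ℝ (Fin d))), ℝ),
      ∃ ℓ : (Fin m → ℂ) →ₗ[ℂ] ℂ, ∀ v, ℓ v = (e.symm v : W).1 φ := fun φ ↦
    ⟨LinearMap.proj φ ∘ₗ W.subtype ∘ₗ e.symm.toLinearMap, fun _ ↦ rfl⟩
  choose ℓ hℓ using hℓ
  obtain ⟨ρ, hρ, hρc, v, hv⟩ := exists_apply_eq_integral_smul hA h0 (e ⟨toFunctional d f, hf⟩)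
  obtain ⟨T, hT⟩ := hW (e.symm v).2
  have hℓA : ∀ φ x, ℓ φ (A x v) = T (translateTest x φ) := fun φ x ↦ by
    rw [hℓ, hcoe, translateFunctional_apply, ← hT, toFunctional_apply]
  let ρ' : 𝓓((⊤ : Opens (EuclideanSpace ℝ (Fin d))), ℝ) := ⟨ρ, hρ, hρc, fun _ _ ↦ trivial⟩
  refine ⟨fun x ↦ ℓ ρ' (A x v), isExponentialPolynomial_of_map_add hA h0 hadd _ _, fun φ ↦ ?_⟩
  have hfφ : f φ = ℓ φ (e ⟨toFunctional d f, hf⟩) := by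
    rw [hℓ, e.symm_apply_apply]
    rfl
  rw [hfφ, hv]
  simp only [hℓA]
  exact integral_mul_apply_translateTest_comm T φ ρ'

/-- A function representing a distribution is unique up to a null set. -/
theorem IsRepresentedBy.ae_eq {f : 𝓓'((⊤ : Opens (EuclideanSpace ℝ (Fin d))), ℂ)}
    {g p : EuclideanSpace ℝ (Fin d) → ℂ} (hg : IsRepresentedBy f g) (hp : IsRepresentedBy f p) :
    g =ᵐ[volume] p := by
  refine ae_eq_of_integral_contDiff_smul_eq hg.1 hp.1 fun φ hφ hφc ↦ ?_
  simp only [Complex.real_smul]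
  exact (hg.2 ⟨φ, hφ, hφc, fun _ _ ↦ trivial⟩).symm.trans (hp.2 ⟨φ, hφ, hφc, fun _ _ ↦ trivial⟩)

end TranslationInvariant

end ExpPoly

theorem theorem2p1 (d s : ℕ) (h : Fin s → EuclideanSpace ℝ (Fin d))
    (hdense : Dense (AddSubgroup.closure (Set.range h) : Set (EuclideanSpace ℝ (Fin d))))
    (f : 𝓓'((⊤ : Opens (EuclideanSpace ℝ (Fin d))), ℂ))
    (n : Fin s → ℕ)
    (hdim : ∀ i, Module.rank ℂ (Submodule.span ℂ
      {g | ∃ k : ℕ, k ≤ n i ∧ g = (ExpPoly.translateDistribution (h i))^[k] f}) ≤ (n i : Cardinal)) :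
    ∃ p : EuclideanSpace ℝ (Fin d) → ℂ,
      ExpPoly.IsExponentialPolynomial p ∧ Continuous p ∧
      ExpPoly.IsRepresentedBy f p ∧
      ∀ g : EuclideanSpace ℝ (Fin d) → ℂ, ExpPoly.IsRepresentedBy f g → g =ᵐ[volume] p := by
  let c := ExpPoly.toFunctional d
  have hpoly : ∀ i, ∃ P : Polynomial ℂ, P ≠ 0 ∧
      Polynomial.aeval (ExpPoly.translateFunctional (h i)) P (c f) = 0 := fun i ↦ by
    refine ExpPoly.exists_aeval_eq_zero_of_rank_span_le _ _ (n i) ?_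
    have hpow : ∀ k : ℕ, (ExpPoly.translateFunctional (h i) ^ k) (c f) =
        c ((ExpPoly.translateDistribution (h i))^[k] f) := fun k ↦ by
      induction k with
      | zero => rfl
      | succ k ih =>
        rw [pow_succ', Module.End.mul_apply, ih, Function.iterate_succ_apply']
        rfl
    have himage : {g | ∃ k : ℕ, k ≤ n i ∧ g = (ExpPoly.translateFunctional (h i) ^ k) (c f)} =
        c '' {g | ∃ k : ℕ, k ≤ n i ∧ g = (ExpPoly.translateDistribution (h i))^[k] f} := by
      ext u
      constructor
      · rintro ⟨k, hk, rfl⟩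
        exact ⟨_, ⟨k, hk, rfl⟩, (hpow k).symm⟩
      · rintro ⟨_, ⟨k, hk, rfl⟩, rfl⟩
        exact ⟨k, hk, (hpow k).symm⟩
    rw [himage, Submodule.span_image]
    exact (rank_map_le c _).trans (hdim i)
  choose P hP hPf using hpoly
  obtain ⟨U, hU, hfU, hinv, -⟩ := ExpPoly.exists_finiteDimensional_invariant
    (fun i ↦ ExpPoly.translateFunctional (h i))
    (fun i j ↦ by
      rw [Commute, SemiconjBy, ← ExpPoly.translateFunctional_add, add_comm,
        ExpPoly.translateFunctional_add])
    P hP (c f) hPf Finset.univ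
  -- Only the distributions in `U` are kept.
  let W := U ⊓ c.range
  have hWinv := ExpPoly.le_comap_translateFunctional_of_dense W inf_le_right hdense (by
    rintro _ ⟨i, rfl⟩ w ⟨hwU, T, rfl⟩
    exact ⟨hinv i (Finset.mem_univ i) hwU, ExpPoly.translateDistribution (h i) T, rfl⟩)
  obtain ⟨p, hp, hfp⟩ := ExpPoly.exists_isExponentialPolynomial_of_invariant W inf_le_right hWinv f
    ⟨hfU, f, rfl⟩
  have hrep : ExpPoly.IsRepresentedBy f p := ⟨hp.continuous.locallyIntegrable, hfp⟩
  exact ⟨p, hp, hp.continuous, hrep, fun g hg ↦ hg.ae_eq hrep⟩
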